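/- Theorem 1. Let $n \ge 2$ and let $p(z) = \prod_{j=1}^{n}(z - z_j)$ be a monic complex polynomial of degree $n$ whose zeros $z_1,\dots,z_n$ are pairwise distinct (that is, simple) and lie in the closed unit disk. Put $$r = \frac1n \min_{1\le i,j\le n,\ i\ne j}|z_i - z_j|, \qquad a_n = n^{1/(n-1)} - 1,$$ and, for $m = \lfloor n/2\rfloor$, $$A_n = 2m\left(\frac{r^2 a_{2m}}{24}\right)^{m}\ \text{ if } n = 2m, \qquad A_n = (2m+1)\,a_{2m+1}^{\,m+1}\left(\frac{r^2\sqrt3}{72}\right)^{m}\ \text{ if } n = 2m+1.$$ If $|p(0)| \le A_n$, then for every zero $\zeta$ of $p$ the closed disk $\{w \in \mathbb C : |w-\zeta| \le 1\}$ contains a zero of the derivative $p'$; that is, Sendov's conjecture holds for $p$. -/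

import Mathlib

noncomputable section

/-- `r = (1/n) · min_{i ≠ j} |z_i - z_j|` for a family of `n` complex numbers. For `n ≥ 2` the
infimum runs over a finite nonempty family, so it is a minimum. -/
def scaledMinSep {n : ℕ} (z : Fin n → ℂ) : ℝ :=
  (1 / (n : ℝ)) * ⨅ q : {q : Fin n × Fin n // q.1 ≠ q.2}, ‖z q.1.1 - z q.1.2‖

/-- `a_n = n^(1/(n-1)) - 1`. -/
def sendovRadius (n : ℕ) : ℝ :=
  (n : ℝ) ^ (1 / ((n : ℝ) - 1)) - 1

/-- The bound `A_n`, as a function of `n` and `r`: with `m = ⌊n/2⌋`, it is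
`n (r² a_n / 24)^m` for `n = 2m`, and `n a_n^(m+1) (r² √3 / 72)^m` for `n = 2m + 1`. -/
def sendovBound (n : ℕ) (r : ℝ) : ℝ :=
  if Even n then
    (n : ℝ) * (r ^ 2 * sendovRadius n / 24) ^ (n / 2)
  else
    (n : ℝ) * sendovRadius n ^ (n / 2 + 1) * (r ^ 2 * √3 / 72) ^ (n / 2)

end

/-!
The theorem follows from two independent ways of finding a critical point close to a zero `ζ`.

If every other zero is at distance at most `1 + a_n = n ^ (1 / (n - 1))` from `ζ`, then
`|p'(ζ)| ≤ n`; as `|p'(ζ)|` is `n` times the product of the distances from `ζ` to the critical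
points, one of these distances is at most `1` (`exists_isRoot_derivative_of_norm_le`).

If some zero `b ≠ ζ` has `|b| ≤ r ^ 2 / 2`, then there is a critical point `w` with
`|w - ζ| ≤ |w - b|` (`exists_isRoot_derivative_norm_sub_le`, a case of Grace's theorem). Separation
of the zeros keeps the critical points at distance at least `r` from all the zeros, and this in turn
keeps them away from the unit circle: `|w| ^ 2 ≤ 1 - r ^ 2` (`norm_sq_le_of_isRoot_derivative`).
Hence `|w - ζ| ≤ |w| + |b| ≤ √(1 - r ^ 2) + r ^ 2 / 2 ≤ 1`.

If neither applies, then some zero is farther than `1 + a_n` from `ζ`, so two zeros have modulus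
greater than `a_n`; all zeros other than `ζ` have modulus greater than `r ^ 2 / 2`; and, the mutual
distances being at least `n r`, at most one zero has modulus less than `n r / 2`. The product of
these strict and non-strict lower bounds is at least `A_n` (`lt_prod_norm`, `sendovBound_le`), so
`|p(0)| > A_n`, contrary to the assumption.

The case of Grace's theorem is proved by normalizing `ζ, b` to `1, -1` and writing the functional
`q ↦ q(1) - q(-1)` as a constant times the successive polar derivatives of `q'` with respect to the
roots of `w ↦ (1 - w) ^ n - (-1 - w) ^ n`. These roots are imaginary, so by Laguerre's theorem
(`polarDerivative_roots_re_neg`) the result is nonzero when the roots of `q'` have negative real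
parts.
-/

open Polynomial

/-! ### Polar derivatives and Laguerre's theorem -/

/-- A real-linear functional `u ↦ re (c * u)` that is less than `k` on a nonempty multiset has its
sum over the multiset less than `card * k`. -/
lemma re_mul_multiset_sum_lt (c : ℂ) (k : ℝ) (S : Multiset ℂ) (hS : S ≠ 0)
    (h : ∀ u ∈ S, (c * u).re < k) : (c * S.sum).re < S.card * k := by
  induction S using Multiset.induction with
  | empty => exact absurd rfl hS
  | cons a S ih =>
    have ha := h a (Multiset.mem_cons_self a S)
    rw [Multiset.sum_cons, Multiset.card_cons, mul_add, Complex.add_re]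
    push_cast
    rcases eq_or_ne S 0 with rfl | hS'
    · simpa using ha
    · linarith [ih hS' fun u hu => h u (Multiset.mem_cons_of_mem hu)]

/-- The polar derivative `n f - (X - ζ) f'` of `f`, seen as a polynomial of degree `n`, with
respect to the pole `ζ`. -/
noncomputable def polarDerivative (n : ℕ) (ζ : ℂ) : ℂ[X] →ₗ[ℂ] ℂ[X] :=
  (n : ℂ) • LinearMap.id - LinearMap.mulLeft ℂ (X - C ζ) ∘ₗ derivative

lemma polarDerivative_apply (n : ℕ) (ζ : ℂ) (f : ℂ[X]) :
    polarDerivative n ζ f = (n : ℂ) • f - (X - C ζ) * derivative f := rfl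

lemma polarDerivative_X_sub_C_pow (n : ℕ) (ζ w : ℂ) :
    polarDerivative (n + 1) ζ ((X - C w) ^ (n + 1)) =
      ((n + 1 : ℂ) * (ζ - w)) • (X - C w) ^ n := by
  rw [polarDerivative_apply, derivative_X_sub_C_pow]
  simp only [smul_eq_C_mul, C_mul, C_sub, C_add, C_1, C_eq_natCast, Nat.add_sub_cancel]
  push_cast
  ring

/-- Laguerre's theorem for half-planes: if the roots of `f` lie in the open left half-plane and
the pole `ζ` does not, then the roots of the polar derivative lie in the open left half-plane, and
its degree drops by exactly one. -/
lemma polarDerivative_roots_re_neg {N : ℕ} {f : ℂ[X]} {ζ : ℂ} (hf : f.natDegree = N + 1)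
    (hr : ∀ s, f.IsRoot s → s.re < 0) (hζ : 0 ≤ ζ.re) :
    (polarDerivative (N + 1) ζ f).natDegree = N ∧
      ∀ z, (polarDerivative (N + 1) ζ f).IsRoot z → z.re < 0 := by
  have hsplit : f.Splits := IsAlgClosed.splits f
  have hf0 : f ≠ 0 := by rintro rfl; simp at hf
  have hcard : f.roots.card = N + 1 := by rw [← hsplit.natDegree_eq_card_roots, hf]
  have hne : f.roots ≠ 0 := by intro h; simp [h] at hcard
  constructor
  · -- The coefficient of `X ^ N` is `lc * ((N + 1) ζ - ∑ s)`, whose second factor has positive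
    -- real part.
    have hnext := hsplit.nextCoeff_eq_neg_sum_roots_mul_leadingCoeff
    rw [nextCoeff_of_natDegree_pos (by omega), hf, Nat.add_sub_cancel] at hnext
    have hlc : f.coeff (N + 1) = f.leadingCoeff := by rw [leadingCoeff, hf]
    have hsum : (f.roots.sum).re < 0 := by
      have := re_mul_multiset_sum_lt 1 0 f.roots hne fun u hu => by
        simpa using hr u (isRoot_of_mem_roots hu)
      simpa using this
    have hcoeff : ∀ k, (polarDerivative (N + 1) ζ f).coeff k =
        (N + 1 - k) * f.coeff k + ζ * (k + 1) * f.coeff (k + 1) := by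
      intro k
      rw [polarDerivative_apply, sub_mul, coeff_sub, coeff_sub, coeff_C_mul, coeff_smul,
        coeff_derivative, smul_eq_mul]
      cases k with
      | zero => simp
      | succ k => rw [coeff_X_mul, coeff_derivative]; push_cast; ring
    refine natDegree_eq_of_le_of_coeff_ne_zero ?_ ?_
    · rw [natDegree_le_iff_coeff_eq_zero]
      intro k hk
      rw [hcoeff, coeff_eq_zero_of_natDegree_lt (n := k + 1) (by omega)]
      rcases eq_or_ne k (N + 1) with rfl | hk'
      · push_cast; ring
      · rw [coeff_eq_zero_of_natDegree_lt (n := k) (by omega)]; ring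
    · rw [hcoeff, hnext, hlc]
      have : (N + 1 - (N : ℂ)) * (-f.leadingCoeff * f.roots.sum) +
          ζ * (N + 1) * f.leadingCoeff =
            f.leadingCoeff * ((N + 1 : ℝ) * ζ - f.roots.sum) := by push_cast; ring
      rw [this]
      refine mul_ne_zero (leadingCoeff_ne_zero.mpr hf0) fun h => ?_
      have h' := congrArg Complex.re h
      rw [Complex.sub_re, Complex.re_ofReal_mul, Complex.zero_re] at h'
      have : 0 ≤ (N + 1 : ℝ) * ζ.re := by positivity
      linarith
  · intro z hz
    by_contra! hx
    have hfz : f.eval z ≠ 0 := fun h => absurd (hr z h) (not_lt.mpr hx)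
    have hz' : (N + 1 : ℂ) * f.eval z = (z - ζ) * (derivative f).eval z := by
      have : (polarDerivative (N + 1) ζ f).eval z = 0 := hz
      rw [polarDerivative_apply] at this
      simp only [eval_sub, eval_smul, eval_mul, eval_X, eval_C, smul_eq_mul] at this
      push_cast at this
      linear_combination this
    have hN : (N + 1 : ℂ) ≠ 0 := by exact_mod_cast N.succ_ne_zero
    have hzζ : z - ζ ≠ 0 := by
      intro h
      rw [h, zero_mul] at hz'
      exact mul_ne_zero hN hfz hz'
    have hsum := hsplit.eval_derivative_div_eval_of_ne_zero hfz
    -- The inverse of `z - ζ` is the mean of the inverses of `z - s`; the latter lie in the open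
    -- disk (or half-plane) `re z * ‖u‖ ^ 2 < re u`, the former does not. The tangent-line bound
    -- for `‖u‖ ^ 2` at `u₀` makes the inequality linear in `u`.
    set u₀ : ℂ := (z - ζ)⁻¹ with hu₀
    have hmean : (f.roots.map fun s => 1 / (z - s)).sum = (N + 1 : ℝ) * u₀ := by
      rw [← hsum, hu₀]
      push_cast
      field_simp
      linear_combination -hz'
    have inv_re_mul : ∀ v : ℂ, v ≠ 0 → v⁻¹.re = v.re * Complex.normSq v⁻¹ := by
      intro v hv
      rw [Complex.inv_re, Complex.normSq_inv, div_eq_mul_inv]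
    have h₀ : u₀.re ≤ z.re * Complex.normSq u₀ := by
      rw [hu₀, inv_re_mul _ hzζ]
      refine mul_le_mul_of_nonneg_right ?_ (Complex.normSq_nonneg _)
      rw [Complex.sub_re]; linarith
    have key := re_mul_multiset_sum_lt (2 * z.re * (starRingEnd ℂ) u₀ - 1)
      (z.re * Complex.normSq u₀) (f.roots.map fun s => 1 / (z - s))
      (by simpa using hne) (by
        intro u hu
        obtain ⟨s, hs, rfl⟩ := Multiset.mem_map.mp hu
        have hs' := hr s (isRoot_of_mem_roots hs)
        have hzs : z - s ≠ 0 := by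
          intro h
          have := congrArg Complex.re h
          rw [Complex.sub_re, Complex.zero_re] at this
          linarith
        rw [one_div]
        have h1 := inv_re_mul _ hzs
        set v := (z - s)⁻¹ with hv
        have hvpos : 0 < Complex.normSq v := Complex.normSq_pos.mpr (inv_ne_zero hzs)
        have h2 : z.re * Complex.normSq v < v.re := by
          rw [h1]
          refine mul_lt_mul_of_pos_right ?_ hvpos
          rw [Complex.sub_re]; linarith
        have h3 := mul_nonneg hx (Complex.normSq_nonneg (v - u₀))
        simp only [Complex.normSq_apply, Complex.sub_re, Complex.sub_im, Complex.mul_re,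
          Complex.mul_im, Complex.conj_re, Complex.conj_im, Complex.ofReal_re, Complex.ofReal_im,
          Complex.one_re, Complex.one_im, Complex.re_ofNat, Complex.im_ofNat] at h2 h3 ⊢
        nlinarith)
    rw [hmean, Multiset.card_map, hcard] at key
    have hN' : (0 : ℝ) < N + 1 := by positivity
    have h4 := mul_le_mul_of_nonneg_left h₀ hN'.le
    simp only [Complex.normSq_apply, Complex.sub_re, Complex.sub_im, Complex.mul_re,
      Complex.mul_im, Complex.conj_re, Complex.conj_im, Complex.ofReal_re, Complex.ofReal_im,
      Complex.one_re, Complex.one_im, Complex.re_ofNat, Complex.im_ofNat] at key h4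
    push_cast at key
    nlinarith

/-- The linear functional on polynomials of degree `l.length` that takes polar derivatives
successively with respect to all the poles in `l`, ending with a constant. -/
noncomputable def iteratedPolar : List ℂ → ℂ[X] →ₗ[ℂ] ℂ
  | [] => lcoeff ℂ 0
  | ζ :: l => iteratedPolar l ∘ₗ polarDerivative (l.length + 1) ζ

lemma iteratedPolar_X_sub_C_pow (l : List ℂ) (w : ℂ) :
    iteratedPolar l ((X - C w) ^ l.length) =
      l.length.factorial * (l.map fun ζ => ζ - w).prod := by
  induction l with
  | nil => simp [iteratedPolar]
  | cons ζ l ih =>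
    rw [iteratedPolar, LinearMap.comp_apply, List.length_cons, polarDerivative_X_sub_C_pow,
      map_smul, ih, List.map_cons, List.prod_cons, Nat.factorial_succ, smul_eq_mul]
    push_cast
    ring

lemma iteratedPolar_ne_zero (l : List ℂ) (hl : ∀ ζ ∈ l, 0 ≤ ζ.re) (f : ℂ[X])
    (hf : f.natDegree = l.length) (hf0 : f ≠ 0) (hr : ∀ s, f.IsRoot s → s.re < 0) :
    iteratedPolar l f ≠ 0 := by
  induction l generalizing f with
  | nil =>
    have := leadingCoeff_ne_zero.mpr hf0
    rw [leadingCoeff, hf] at this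
    simpa [iteratedPolar] using this
  | cons ζ l ih =>
    obtain ⟨h1, h2⟩ := polarDerivative_roots_re_neg hf hr (hl ζ (by simp))
    refine ih (fun ζ' h => hl ζ' (by simp [h])) _ h1 ?_ h2
    -- The zero polynomial would have the root `0`.
    intro h
    have := h2 0 (by rw [h]; simp)
    simp at this

/-- The powers `(X - w) ^ N` span the polynomials of degree at most `N`. -/
lemma linearMap_eq_zero_of_X_sub_C_pow (N : ℕ) (L : ℂ[X] →ₗ[ℂ] ℂ)
    (h : ∀ w, L ((X - C w) ^ N) = 0) (f : ℂ[X]) (hf : f.natDegree ≤ N) : L f = 0 := by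
  have hexp : ∀ w : ℂ, (X - C w) ^ N =
      ∑ j ∈ Finset.range (N + 1), ((-w) ^ (N - j) * (N.choose j : ℂ)) • (X : ℂ[X]) ^ j := by
    intro w
    rw [sub_eq_add_neg, ← C_neg, add_pow]
    refine Finset.sum_congr rfl fun j _ => ?_
    rw [smul_eq_C_mul, C_mul, C_pow, C_eq_natCast]
    ring
  set P : ℂ[X] :=
    ∑ j ∈ Finset.range (N + 1), C ((N.choose j : ℂ) * L (X ^ j)) * X ^ (N - j) with hP
  have hP0 : P = 0 := by
    refine Polynomial.funext fun w => ?_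
    have := h (-w)
    rw [hexp, map_sum] at this
    rw [eval_zero, ← this, hP, eval_finsetSum]
    refine Finset.sum_congr rfl fun j _ => ?_
    simp only [map_smul, smul_eq_mul, eval_mul, eval_C, eval_pow, eval_X, neg_neg]
    ring
  have hX : ∀ j ≤ N, L (X ^ j) = 0 := by
    intro j hj
    have hc : P.coeff (N - j) = (N.choose j : ℂ) * L (X ^ j) := by
      rw [hP, finsetSum_coeff, Finset.sum_eq_single j]
      · rw [coeff_C_mul_X_pow, if_pos rfl]
      · intro k hk hkj
        rw [coeff_C_mul_X_pow, if_neg]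
        have := Finset.mem_range.mp hk
        omega
      · intro hj'; simp at hj'; omega
    rw [hP0, coeff_zero] at hc
    exact (mul_eq_zero.mp hc.symm).resolve_left
      (Nat.cast_ne_zero.mpr (Nat.choose_pos hj).ne')
  rw [f.as_sum_range' (N + 1) (by omega), map_sum]
  refine Finset.sum_eq_zero fun j hj => ?_
  rw [← C_mul_X_pow_eq_monomial, ← smul_eq_C_mul, map_smul,
    hX j (by have := Finset.mem_range.mp hj; omega), smul_zero]

/-! ### Critical points and perpendicular bisectors -/

/-- If `q` takes the same value at `1` and `-1`, then it has a critical point in the closed right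
half-plane. On polynomials of degree at most `N + 1`, the functional `q ↦ q(1) - q(-1)` is a
multiple of the iterated polar derivative of `q'` whose poles are the roots of
`w ↦ (1 - w) ^ (N + 1) - (-1 - w) ^ (N + 1)`, and these roots are imaginary. -/
lemma exists_isRoot_derivative_re_nonneg (q : ℂ[X]) (h : q.eval 1 = q.eval (-1)) :
    ∃ s, (derivative q).IsRoot s ∧ 0 ≤ s.re := by
  by_contra! hr
  have hq' : derivative q ≠ 0 := fun h0 => by
    have := hr 0 (by rw [h0]; simp)
    simp at this
  obtain ⟨N, hN⟩ : ∃ N, q.natDegree = N + 1 := by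
    refine Nat.exists_eq_succ_of_ne_zero fun h0 => hq' ?_
    rw [eq_C_of_natDegree_eq_zero h0, derivative_C]
  have hdeg : (derivative q).natDegree = N := by
    rw [natDegree_derivative, hN, Nat.add_sub_cancel]
  set Q : ℂ[X] := (X - C 1) ^ (N + 1) - (X - C (-1)) ^ (N + 1) with hQ
  have hQcoeff : Q.coeff N = -2 * (N + 1) := by
    rw [hQ, coeff_sub, sub_eq_add_neg X, sub_eq_add_neg X, ← C_neg, ← C_neg, coeff_X_add_C_pow,
      coeff_X_add_C_pow]
    simp
    ring
  have hQdeg : Q.natDegree = N := by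
    refine natDegree_eq_of_le_of_coeff_ne_zero ?_ ?_
    · rw [natDegree_le_iff_coeff_eq_zero]
      intro k hk
      rw [hQ, coeff_sub, sub_eq_add_neg X, sub_eq_add_neg X, ← C_neg, ← C_neg,
        coeff_X_add_C_pow, coeff_X_add_C_pow]
      rcases eq_or_ne k (N + 1) with rfl | hk'
      · simp
      · rw [Nat.choose_eq_zero_of_lt (by omega)]; simp
    · rw [hQcoeff]
      exact mul_ne_zero (by norm_num) (by exact_mod_cast N.succ_ne_zero)
  have hQ0 : Q ≠ 0 := by
    intro h0
    rw [h0, coeff_zero] at hQcoeff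
    exact mul_ne_zero (by norm_num) (by exact_mod_cast N.succ_ne_zero) hQcoeff.symm
  have hQs : Q.Splits := IsAlgClosed.splits Q
  have hQroots : ∀ ζ ∈ Q.roots.toList, 0 ≤ ζ.re := by
    intro ζ hζ
    have h1 : Q.eval ζ = 0 := isRoot_of_mem_roots (Multiset.mem_toList.mp hζ)
    simp only [hQ, eval_sub, eval_pow, eval_X, eval_C] at h1
    have h2 : ‖ζ - 1‖ = ‖ζ - -1‖ := by
      have := congrArg norm (sub_eq_zero.mp h1)
      rw [norm_pow, norm_pow] at this
      exact (pow_left_inj₀ (norm_nonneg _) (norm_nonneg _) N.succ_ne_zero).mp this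
    have h3 := congrArg (· ^ 2) h2
    simp only [← Complex.normSq_eq_norm_sq, Complex.normSq_apply, Complex.sub_re, Complex.sub_im,
      Complex.neg_re, Complex.neg_im, Complex.one_re, Complex.one_im] at h3
    linarith
  have hlen : Q.roots.toList.length = N := by
    rw [Multiset.length_toList, ← hQs.natDegree_eq_card_roots, hQdeg]
  have hprod : ∀ w, (Q.roots.toList.map fun ζ => ζ - w).prod =
      (-1) ^ N * (Q.roots.map fun ζ => w - ζ).prod := by
    intro w
    have h1 : (fun ζ => ζ - w) = fun ζ : ℂ => (-1) * (w - ζ) := by funext ζ; ring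
    rw [← Multiset.prod_coe, ← Multiset.map_coe, Multiset.coe_toList, h1,
      Multiset.prod_map_mul, Multiset.map_const', Multiset.prod_replicate,
      ← hQs.natDegree_eq_card_roots, hQdeg]
  have hQeval : ∀ w, Q.eval w = Q.leadingCoeff * (Q.roots.map fun ζ => w - ζ).prod := by
    intro w
    conv_lhs => rw [hQs.eq_prod_roots]
    simp [eval_multiset_prod]
  set L : ℂ[X] →ₗ[ℂ] ℂ :=
    ((N + 1 : ℂ) * N.factorial) • (leval 1 - leval (-1)) +
      Q.leadingCoeff • (iteratedPolar Q.roots.toList ∘ₗ derivative) with hL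
  have hLpow : ∀ w, L ((X - C w) ^ (N + 1)) = 0 := by
    intro w
    have h1 : ((1 : ℂ) - w) ^ (N + 1) - (-1 - w) ^ (N + 1) = (-1) ^ (N + 1) * Q.eval w := by
      simp only [hQ, eval_sub, eval_pow, eval_X, eval_C]
      rw [mul_sub, ← mul_pow, ← mul_pow]
      ring
    have h2 := iteratedPolar_X_sub_C_pow Q.roots.toList w
    rw [hlen, hprod] at h2
    simp only [hL, LinearMap.add_apply, LinearMap.smul_apply, LinearMap.sub_apply,
      LinearMap.comp_apply, leval_apply, eval_pow, eval_sub, eval_X, eval_C]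
    rw [h1, derivative_X_sub_C_pow, C_eq_natCast, ← nsmul_eq_mul, map_nsmul, Nat.add_sub_cancel,
      h2, hQeval]
    simp only [smul_eq_mul, nsmul_eq_mul]
    push_cast
    ring
  have hLq := linearMap_eq_zero_of_X_sub_C_pow (N + 1) L hLpow q hN.le
  simp only [hL, LinearMap.add_apply, LinearMap.smul_apply, LinearMap.sub_apply,
    LinearMap.comp_apply, leval_apply, h, sub_self, mul_zero, zero_add, smul_eq_mul] at hLq
  exact mul_ne_zero (leadingCoeff_ne_zero.mpr hQ0)
    (iteratedPolar_ne_zero _ hQroots _ (by rw [hdeg, hlen]) hq' hr) hLq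

/-- If `p a = p b`, then the closed half-plane of the points that are at least as close to `a` as
to `b` contains a critical point of `p`. -/
lemma exists_isRoot_derivative_norm_sub_le (p : ℂ[X]) {a b : ℂ} (hab : a ≠ b)
    (h : p.eval a = p.eval b) : ∃ w, (derivative p).IsRoot w ∧ ‖w - a‖ ≤ ‖w - b‖ := by
  set c : ℂ := (a + b) / 2 with hc
  set d : ℂ := (a - b) / 2 with hd
  have hd0 : d ≠ 0 := div_ne_zero (sub_ne_zero.mpr hab) two_ne_zero
  obtain ⟨s, hs, hre⟩ := exists_isRoot_derivative_re_nonneg (p.comp (C d * X + C c)) (by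
    simp only [eval_comp, eval_add, eval_mul, eval_C, eval_X]
    rw [show d * 1 + c = a by rw [hc, hd]; ring, show d * -1 + c = b by rw [hc, hd]; ring, h])
  refine ⟨d * s + c, ?_, ?_⟩
  · rw [IsRoot, derivative_comp] at hs
    simpa [eval_comp, hd0] using hs
  · rw [show d * s + c - a = d * (s - 1) by rw [hc, hd]; ring,
      show d * s + c - b = d * (s + 1) by rw [hc, hd]; ring, norm_mul, norm_mul]
    refine mul_le_mul_of_nonneg_left ?_ (norm_nonneg d)
    rw [← sq_le_sq₀ (norm_nonneg _) (norm_nonneg _), ← Complex.normSq_eq_norm_sq,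
      ← Complex.normSq_eq_norm_sq]
    simp only [Complex.normSq_apply, Complex.sub_re, Complex.sub_im, Complex.add_re,
      Complex.add_im, Complex.one_re, Complex.one_im]
    linarith

/-! ### Critical points of a polynomial with separated zeros in the unit disk -/

lemma derivative_prod_X_sub_C_eval_self {n : ℕ} (z : Fin n → ℂ) (i : Fin n) :
    (derivative (∏ j, (X - C (z j)))).eval (z i) = ∏ j ∈ Finset.univ.erase i, (z i - z j) := by
  rw [derivative_prod_finset, eval_finsetSum, Finset.sum_eq_single i]
  · simp [eval_prod]
  · intro k _ hk
    rw [eval_mul, eval_prod, Finset.prod_eq_zero (i := i) (by simp [hk.symm]) (by simp), zero_mul]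
  · simp

/-- At a critical point of a polynomial with simple zeros, the logarithmic derivative vanishes. -/
lemma sum_inv_sub_eq_zero {n : ℕ} {z : Fin n → ℂ} (hz : Function.Injective z) {w : ℂ}
    (hw : (derivative (∏ j, (X - C (z j)))).IsRoot w) :
    (∀ j, w - z j ≠ 0) ∧ ∑ j, (w - z j)⁻¹ = 0 := by
  have hne : ∀ j, w - z j ≠ 0 := by
    intro j hj
    rw [sub_eq_zero.mp hj, IsRoot, derivative_prod_X_sub_C_eval_self,
      Finset.prod_eq_zero_iff] at hw
    obtain ⟨k, hk, hk'⟩ := hw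
    exact (Finset.mem_erase.mp hk).1 (hz (sub_eq_zero.mp hk')).symm
  refine ⟨hne, ?_⟩
  have hP : ∏ j, (w - z j) ≠ 0 := Finset.prod_ne_zero_iff.mpr fun j _ => hne j
  have h : (∏ j, (w - z j)) * ∑ j, (w - z j)⁻¹ = 0 := by
    rw [IsRoot, derivative_prod_finset, eval_finsetSum] at hw
    rw [← hw, Finset.mul_sum]
    refine Finset.sum_congr rfl fun j _ => ?_
    rw [← Finset.prod_erase_mul _ _ (Finset.mem_univ j), mul_assoc, mul_inv_cancel₀ (hne j)]
    simp [eval_prod]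
  exact (mul_eq_zero.mp h).resolve_left hP

/-- If the zeros are at mutual distance at least `n r`, then every critical point is at distance
at least `r` from every zero: otherwise the term of the nearby zero would dominate the logarithmic
derivative. -/
lemma le_norm_sub_of_isRoot_derivative {n : ℕ} (hn : 2 ≤ n) {z : Fin n → ℂ}
    (hz : Function.Injective z) {r : ℝ} (hr : 0 < r)
    (hsep : ∀ i j, i ≠ j → n * r ≤ ‖z i - z j‖) {w : ℂ}
    (hw : (derivative (∏ j, (X - C (z j)))).IsRoot w) (i : Fin n) : r ≤ ‖w - z i‖ := by
  obtain ⟨hne, hsum⟩ := sum_inv_sub_eq_zero hz hw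
  by_contra! hlt
  have hn1 : (0 : ℝ) < n - 1 := by
    have : (2 : ℝ) ≤ n := by exact_mod_cast hn
    linarith
  have hfar : ∀ j ∈ Finset.univ.erase i, ‖(w - z j)⁻¹‖ ≤ ((n - 1) * r)⁻¹ := by
    intro j hj
    rw [norm_inv]
    refine inv_anti₀ (mul_pos hn1 hr) ?_
    have h1 := hsep i j (Finset.mem_erase.mp hj).1.symm
    have h2 := norm_sub_le_norm_sub_add_norm_sub (z i) w (z j)
    rw [norm_sub_rev (z i) w] at h2
    linarith
  have h1 : ‖(w - z i)⁻¹‖ ≤ r⁻¹ := by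
    rw [← Finset.add_sum_erase _ _ (Finset.mem_univ i)] at hsum
    rw [eq_neg_of_add_eq_zero_left hsum, norm_neg]
    refine (norm_sum_le_of_le _ hfar).trans_eq ?_
    rw [Finset.sum_const, Finset.card_erase_of_mem (Finset.mem_univ i), Finset.card_univ,
      Fintype.card_fin, nsmul_eq_mul, Nat.cast_sub (by omega), Nat.cast_one]
    field_simp
  rw [norm_inv, inv_le_inv₀ (norm_pos_iff.mpr (hne i)) hr] at h1
  linarith

/-- A critical point at distance at least `r` from all the zeros is not close to the unit circle:
otherwise every term of `∑ w / (w - z_j)` would have positive real part. -/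
lemma norm_sq_le_of_isRoot_derivative {n : ℕ} (hn : 2 ≤ n) {z : Fin n → ℂ}
    (hz : Function.Injective z) (hdisk : ∀ j, ‖z j‖ ≤ 1) {r : ℝ} {w : ℂ}
    (hw : (derivative (∏ j, (X - C (z j)))).IsRoot w) (hr : 0 < r)
    (hdist : ∀ j, r ≤ ‖w - z j‖) : ‖w‖ ^ 2 ≤ 1 - r ^ 2 := by
  obtain ⟨hne, hsum⟩ := sum_inv_sub_eq_zero hz hw
  by_contra! hlt
  have hterm : ∀ j, 0 < (w * (w - z j)⁻¹).re := by
    intro j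
    have h1 : (w * (w - z j)⁻¹).re =
        (‖w - z j‖ ^ 2 + ‖w‖ ^ 2 - ‖z j‖ ^ 2) / (2 * ‖w - z j‖ ^ 2) := by
      have h0 := Complex.normSq_pos.mpr (hne j)
      simp only [← Complex.normSq_eq_norm_sq, Complex.mul_re, Complex.inv_re, Complex.inv_im]
      field_simp
      simp only [Complex.normSq_apply, Complex.sub_re, Complex.sub_im]
      ring
    rw [h1]
    have h2 : r ^ 2 ≤ ‖w - z j‖ ^ 2 := pow_le_pow_left₀ hr.le (hdist j) 2
    have h3 : ‖z j‖ ^ 2 ≤ 1 := pow_le_one₀ (norm_nonneg _) (hdisk j)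
    have h4 : 0 < r ^ 2 := by positivity
    exact div_pos (by linarith) (by linarith)
  have hpos : 0 < ∑ j, (w * (w - z j)⁻¹).re :=
    Finset.sum_pos (fun j _ => hterm j) ⟨⟨0, by omega⟩, Finset.mem_univ _⟩
  rw [← Complex.re_sum, ← Finset.mul_sum, hsum, mul_zero, Complex.zero_re] at hpos
  exact lt_irrefl _ hpos

lemma one_lt_multiset_prod (S : Multiset ℝ) (hS : S ≠ 0) (h : ∀ x ∈ S, 1 < x) : 1 < S.prod := by
  induction S using Multiset.induction with
  | empty => exact absurd rfl hS
  | cons a S ih =>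
    have ha := h a (Multiset.mem_cons_self a S)
    rw [Multiset.prod_cons]
    rcases eq_or_ne S 0 with rfl | hS'
    · simpa using ha
    · nlinarith [ih hS' fun u hu => h u (Multiset.mem_cons_of_mem hu)]

/-- If `|p'(ζ)| ≤ n` for a monic polynomial `p` of degree `n ≥ 2`, then some critical point is at
distance at most `1` from `ζ`, as `|p'(ζ)|` is `n` times the product of the distances. -/
lemma exists_isRoot_derivative_of_norm_le {p : ℂ[X]} (hp : p.Monic) (hn : 2 ≤ p.natDegree)
    {ζ : ℂ} (h : ‖(derivative p).eval ζ‖ ≤ p.natDegree) :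
    ∃ w, (derivative p).IsRoot w ∧ ‖w - ζ‖ ≤ 1 := by
  by_contra! hfar
  have hs : (derivative p).Splits := IsAlgClosed.splits _
  have hdeg : (derivative p).natDegree = p.natDegree - 1 := natDegree_derivative p
  have hlc : (derivative p).leadingCoeff = p.natDegree := by
    rw [leadingCoeff, hdeg, coeff_derivative, Nat.sub_add_cancel (by omega), hp.coeff_natDegree,
      Nat.cast_sub (by omega)]
    simp
  have hne : (derivative p).roots ≠ 0 := hs.roots_ne_zero (by omega)
  have heval : ‖(derivative p).eval ζ‖ =
      p.natDegree * ((derivative p).roots.map fun w => ‖ζ - w‖).prod := by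
    conv_lhs => rw [hs.eq_prod_roots]
    rw [hlc, eval_mul, eval_multiset_prod, norm_mul]
    have hnorm : ∀ S : Multiset ℂ, ‖S.prod‖ = (S.map norm).prod :=
      fun S => map_multiset_prod (normHom : ℂ →*₀ ℝ) S
    simp [Multiset.map_map, hnorm]
  have hprod := one_lt_multiset_prod ((derivative p).roots.map fun w => ‖ζ - w‖)
    (by simpa using hne) (by
      intro x hx
      obtain ⟨w, hw, rfl⟩ := Multiset.mem_map.mp hx
      rw [norm_sub_rev]
      exact hfar w (isRoot_of_mem_roots hw))
  have hn0 : (0 : ℝ) < p.natDegree := by exact_mod_cast (by omega : 0 < p.natDegree)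
  rw [heval] at h
  nlinarith

/-! ### The constants of the statement -/

lemma scaledMinSep_pos {n : ℕ} (hn : 2 ≤ n) {z : Fin n → ℂ} (hz : Function.Injective z) :
    0 < scaledMinSep z := by
  have : Nonempty {q : Fin n × Fin n // q.1 ≠ q.2} :=
    ⟨⟨(⟨0, by omega⟩, ⟨1, by omega⟩), by simp⟩⟩
  obtain ⟨q, hq⟩ := exists_eq_ciInf_of_finite
    (f := fun q : {q : Fin n × Fin n // q.1 ≠ q.2} => ‖z q.1.1 - z q.1.2‖)
  rw [scaledMinSep, ← hq]
  have h1 : 0 < ‖z q.1.1 - z q.1.2‖ := norm_pos_iff.mpr (sub_ne_zero.mpr (hz.ne q.2))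
  have h2 : (0 : ℝ) < n := by exact_mod_cast (by omega : 0 < n)
  positivity

lemma mul_scaledMinSep_le {n : ℕ} (hn : 2 ≤ n) (z : Fin n → ℂ) {i j : Fin n} (hij : i ≠ j) :
    n * scaledMinSep z ≤ ‖z i - z j‖ := by
  have h2 : (n : ℝ) ≠ 0 := by exact_mod_cast (by omega : n ≠ 0)
  rw [scaledMinSep, ← mul_assoc, mul_one_div_cancel h2, one_mul]
  exact ciInf_le (f := fun q : {q : Fin n × Fin n // q.1 ≠ q.2} => ‖z q.1.1 - z q.1.2‖)
    (Set.finite_range _).bddBelow ⟨(i, j), hij⟩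

lemma one_add_sendovRadius_pow {n : ℕ} (hn : 2 ≤ n) : (1 + sendovRadius n) ^ (n - 1) = n := by
  have h1 : (n : ℝ) - 1 = ((n - 1 : ℕ) : ℝ) := by rw [Nat.cast_sub (by omega)]; simp
  rw [sendovRadius, add_sub_cancel, h1, one_div]
  exact Real.rpow_inv_natCast_pow (by positivity) (by omega)

lemma sendovRadius_pos {n : ℕ} (hn : 2 ≤ n) : 0 < sendovRadius n := by
  have h : (2 : ℝ) ≤ n := by exact_mod_cast hn
  have := Real.one_lt_rpow (x := n) (z := 1 / ((n : ℝ) - 1)) (by linarith)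
    (by apply one_div_pos.mpr; linarith)
  rw [sendovRadius]
  linarith

lemma sendovRadius_le_one {n : ℕ} (hn : 2 ≤ n) : sendovRadius n ≤ 1 := by
  by_contra! hlt
  have h1 := one_add_sendovRadius_pow hn
  have h2 : (2 : ℝ) ^ (n - 1) < (1 + sendovRadius n) ^ (n - 1) :=
    pow_lt_pow_left₀ (by linarith) (by norm_num) (by omega)
  have h3 : n ≤ 2 ^ (n - 1) := by
    have := (n - 1).lt_two_pow_self
    omega
  have h4 : (n : ℝ) ≤ 2 ^ (n - 1) := by exact_mod_cast h3
  linarith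

/-- The right-hand side is a lower bound for the product of the moduli of `n` zeros of which two
have modulus at least `a_n`, a third has modulus at least `r ^ 2 / 2`, and the remaining ones have
modulus at least `n r / 2`; see `lt_prod_norm`. -/
lemma sendovBound_le {n : ℕ} (hn : 3 ≤ n) {r : ℝ} (hr : 0 < r) (hnr : n * r ≤ 2) :
    sendovBound n r ≤
      sendovRadius n ^ 2 * (r ^ 2 / 2) * (n * r / 2) ^ (n - 3) := by
  have ha0 := sendovRadius_pos (n := n) (by omega)
  have ha1 := sendovRadius_le_one (n := n) (by omega)
  set a := sendovRadius n
  rw [sendovBound]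
  split_ifs with he
  · obtain ⟨m, hm⟩ := even_iff_exists_two_mul.mp he
    obtain ⟨k, rfl⟩ : ∃ k, m = k + 2 := ⟨m - 2, by omega⟩
    have e1 : n / 2 = k + 2 := by omega
    have e2 : n - 3 = 2 * k + 1 := by omega
    have e3 : (n : ℝ) = 2 * (k + 2) := by rw [hm]; push_cast; ring
    rw [e1, e2]
    have hr1 : r ≤ 1 := by rw [e3] at hnr; nlinarith [(k.cast_nonneg : (0 : ℝ) ≤ k)]
    have hnum : (n : ℝ) ≤ 288 * 24 ^ k := by
      have : n ≤ 288 * 24 ^ k := by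
        have : k < 24 ^ k := Nat.lt_pow_self (by norm_num)
        omega
      exact_mod_cast this
    have hbase : r ≤ n * r / 2 := by
      rw [e3]; nlinarith [(k.cast_nonneg : (0 : ℝ) ≤ k)]
    calc (n : ℝ) * (r ^ 2 * a / 24) ^ (k + 2)
        = n * (r * (r ^ (2 * k + 3) * (a ^ k * a ^ 2))) / 24 ^ (k + 2) := by
          rw [div_pow, mul_pow]; ring
      _ ≤ 288 * 24 ^ k * (1 * (r ^ (2 * k + 3) * (1 * a ^ 2))) / 24 ^ (k + 2) := by
          gcongr
          exact pow_le_one₀ ha0.le ha1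
      _ = a ^ 2 * (r ^ 2 / 2) * r ^ (2 * k + 1) := by
          field_simp
          ring
      _ ≤ a ^ 2 * (r ^ 2 / 2) * (n * r / 2) ^ (2 * k + 1) := by gcongr
  · obtain ⟨m, hm⟩ := Nat.not_even_iff_odd.mp he
    obtain ⟨k, rfl⟩ : ∃ k, m = k + 1 := ⟨m - 1, by omega⟩
    have e1 : n / 2 = k + 1 := by omega
    have e2 : n - 3 = 2 * k := by omega
    have e3 : (n : ℝ) = 2 * k + 3 := by rw [hm]; push_cast; ring
    rw [e1, e2]
    have hnum : (n : ℝ) ≤ 18 * 36 ^ k := by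
      have : n ≤ 18 * 36 ^ k := by
        have : k < 36 ^ k := Nat.lt_pow_self (by norm_num)
        omega
      exact_mod_cast this
    have hsqrt : √3 ≤ 2 := by
      rw [Real.sqrt_le_left (by norm_num)]; norm_num
    have hbase : r ≤ n * r / 2 := by
      rw [e3]; nlinarith [(k.cast_nonneg : (0 : ℝ) ≤ k)]
    calc (n : ℝ) * a ^ (k + 1 + 1) * (r ^ 2 * √3 / 72) ^ (k + 1)
        ≤ 18 * 36 ^ k * (1 * a ^ 2) * (r ^ 2 * 2 / 72) ^ (k + 1) := by
          rw [show a ^ (k + 1 + 1) = a ^ k * a ^ 2 by ring]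
          gcongr
          exact pow_le_one₀ ha0.le ha1
      _ = a ^ 2 * (r ^ 2 / 2) * r ^ (2 * k) := by
          rw [show r ^ 2 * 2 / 72 = r ^ 2 / 36 by ring, div_pow]
          field_simp
          ring
      _ ≤ a ^ 2 * (r ^ 2 / 2) * (n * r / 2) ^ (2 * k) := by gcongr

/-- If two of at least three zeros have modulus greater than `a`, and all zeros but one of these two
have modulus greater than `r ^ 2 / 2`, then the stated lower bound holds: by separation, all zeros
except at most one have modulus at least `n r / 2`. -/
lemma lt_prod_norm {n : ℕ} (hn : 3 ≤ n) {z : Fin n → ℂ} {r a : ℝ} (hr : 0 < r) (ha : 0 < a)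
    (hsep : ∀ i j, i ≠ j → n * r ≤ ‖z i - z j‖) {i j : Fin n} (hij : i ≠ j)
    (hi : a < ‖z i‖) (hj : a < ‖z j‖) (hsmall : ∀ k, k ≠ i → r ^ 2 / 2 < ‖z k‖) :
    a ^ 2 * (r ^ 2 / 2) * (n * r / 2) ^ (n - 3) < ∏ k, ‖z k‖ := by
  set S : Finset (Fin n) := (Finset.univ.erase i).erase j with hS
  have hji : j ∈ Finset.univ.erase i := by simp [hij.symm]
  have hScard : S.card = n - 2 := by
    rw [hS, Finset.card_erase_of_mem hji, Finset.card_erase_of_mem (Finset.mem_univ i),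
      Finset.card_univ, Fintype.card_fin]
    omega
  obtain ⟨k, hk, hmin⟩ := S.exists_min_image (fun k => ‖z k‖)
    (Finset.card_pos.mp (by omega))
  have hki : k ≠ i := by
    rw [hS] at hk
    exact (Finset.mem_erase.mp (Finset.mem_erase.mp hk).2).1
  have hrest : (n * r / 2) ^ (n - 3) ≤ ∏ l ∈ S.erase k, ‖z l‖ := by
    have hc : (S.erase k).card = n - 3 := by rw [Finset.card_erase_of_mem hk, hScard]; omega
    rw [← hc, ← Finset.prod_const]
    refine Finset.prod_le_prod (fun _ _ => by positivity) fun l hl => ?_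
    obtain ⟨hlk, hlS⟩ := Finset.mem_erase.mp hl
    have h1 := hsep l k hlk
    have h2 := norm_sub_le (z l) (z k)
    have h3 := hmin l hlS
    linarith
  have hn0 : (0 : ℝ) < n := by exact_mod_cast (by omega : 0 < n)
  rw [← Finset.mul_prod_erase _ _ (Finset.mem_univ i), ← Finset.mul_prod_erase _ _ hji,
    ← Finset.mul_prod_erase _ _ hk]
  have hpos : 0 < (n * r / 2) ^ (n - 3) := by positivity
  calc a ^ 2 * (r ^ 2 / 2) * (n * r / 2) ^ (n - 3)
      = a * (a * (r ^ 2 / 2 * (n * r / 2) ^ (n - 3))) := by ring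
    _ < ‖z i‖ * (‖z j‖ * (‖z k‖ * ∏ l ∈ S.erase k, ‖z l‖)) := by
      have h1 : r ^ 2 / 2 * (n * r / 2) ^ (n - 3) < ‖z k‖ * ∏ l ∈ S.erase k, ‖z l‖ :=
        mul_lt_mul (hsmall k hki) hrest hpos (norm_nonneg _)
      have h2 : 0 < r ^ 2 / 2 * (n * r / 2) ^ (n - 3) := by positivity
      have h3 := mul_lt_mul'' hj h1 ha.le h2.le
      exact mul_lt_mul'' hi h3 ha.le (by positivity)

theorem theorem1 (n : ℕ) (hn : 2 ≤ n) (z : Fin n → ℂ) (hz : Function.Injective z)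
    (hdisk : ∀ j, ‖z j‖ ≤ 1) (p : Polynomial ℂ)
    (hp : p = ∏ j, (Polynomial.X - Polynomial.C (z j)))
    (h0 : ‖p.eval 0‖ ≤ sendovBound n (scaledMinSep z)) :
    ∀ ζ : ℂ, p.IsRoot ζ → ∃ w ∈ Metric.closedBall ζ 1, (Polynomial.derivative p).IsRoot w := by
  intro ζ hζ
  suffices ∃ w, (derivative p).IsRoot w ∧ ‖w - ζ‖ ≤ 1 by
    obtain ⟨w, hw, hw'⟩ := this
    exact ⟨w, by rwa [mem_closedBall_iff_norm], hw⟩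
  obtain ⟨i, rfl⟩ : ∃ i, z i = ζ := by
    rw [hp, IsRoot, eval_prod, Finset.prod_eq_zero_iff] at hζ
    obtain ⟨i, -, hi⟩ := hζ
    exact ⟨i, by simpa [sub_eq_zero, eq_comm] using hi⟩
  have hmonic : p.Monic := by rw [hp]; exact monic_prod_X_sub_C z Finset.univ
  have hdeg : p.natDegree = n := by rw [hp]; simp
  have hr := scaledMinSep_pos hn hz
  have hsep : ∀ i j, i ≠ j → n * scaledMinSep z ≤ ‖z i - z j‖ :=
    fun i j hij => mul_scaledMinSep_le hn z hij
  set r := scaledMinSep z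
  have ha0 := sendovRadius_pos hn
  have ha1 := sendovRadius_le_one hn
  have hpow := one_add_sendovRadius_pow hn
  by_cases hclose : ∀ j ∈ Finset.univ.erase i, ‖z i - z j‖ ≤ 1 + sendovRadius n
  · refine exists_isRoot_derivative_of_norm_le hmonic (by rwa [hdeg]) ?_
    rw [hp, derivative_prod_X_sub_C_eval_self, ← hp, hdeg, norm_prod]
    refine (Finset.prod_le_prod (fun _ _ => norm_nonneg _) hclose).trans_eq ?_
    rw [Finset.prod_const, Finset.card_erase_of_mem (Finset.mem_univ i), Finset.card_univ,
      Fintype.card_fin, hpow]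
  push Not at hclose
  obtain ⟨j, hj, hij⟩ := hclose
  have hij' : i ≠ j := (Finset.mem_erase.mp hj).1.symm
  have htri := norm_sub_le (z i) (z j)
  have hn3 : 3 ≤ n := by
    -- For `n = 2` the radius is `a_2 = 1`.
    by_contra! hlt
    obtain rfl : n = 2 := by omega
    norm_num at hpow
    linarith [hdisk i, hdisk j]
  have hnr : n * r ≤ 2 := by linarith [hsep i j hij', hdisk i, hdisk j]
  by_cases hnear : ∃ k, k ≠ i ∧ ‖z k‖ ≤ r ^ 2 / 2
  · obtain ⟨k, hki, hk⟩ := hnear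
    have hroot : ∀ k, p.eval (z k) = 0 := by
      intro k
      rw [hp, eval_prod]
      exact Finset.prod_eq_zero (Finset.mem_univ k) (by simp)
    obtain ⟨w, hw, hwle⟩ := exists_isRoot_derivative_norm_sub_le p (hz.ne hki.symm)
      ((hroot i).trans (hroot k).symm)
    refine ⟨w, hw, hwle.trans ?_⟩
    rw [hp] at hw
    have h1 := norm_sq_le_of_isRoot_derivative hn hz hdisk hw hr
      (le_norm_sub_of_isRoot_derivative hn hz hr hsep hw)
    have hr1 : r ≤ 1 := by
      have : (2 : ℝ) ≤ n := by exact_mod_cast hn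
      nlinarith
    -- `√(1 - r ^ 2) ≤ 1 - r ^ 2 / 2`
    have h2 : ‖w‖ ≤ 1 - r ^ 2 / 2 :=
      abs_le_of_sq_le_sq' (by nlinarith [sq_nonneg (r ^ 2)]) (by nlinarith) |>.2
    linarith [norm_sub_le w (z k)]
  · push Not at hnear
    have h1 := lt_prod_norm hn3 hr ha0 hsep hij' (by linarith [hdisk j]) (by linarith [hdisk i])
      hnear
    have h2 := sendovBound_le hn3 hr hnr
    have h3 : ‖p.eval 0‖ = ∏ k, ‖z k‖ := by
      rw [hp, eval_prod, norm_prod]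
      simp
    linarith
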